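/- For $n\ge 1$, let $\mathcal{C}_n$ be the set of nonnesting permutations of the multiset $\{1,1,2,2,\dots,n,n\}$, that is, the words $\pi=\pi_1\pi_2\cdots\pi_{2n}$ containing each of $1,\dots,n$ exactly twice and avoiding the patterns $1221$ and $2112$. Here a word $\pi$ contains a pattern $\sigma=\sigma_1\cdots\sigma_k$ if there are indices $i_1<\dots<i_k$ such that, for all $r,s$, $\pi_{i_r}<\pi_{i_s}$ if and only if $\sigma_r<\sigma_s$, and $\pi_{i_r}=\pi_{i_s}$ if and only if $\sigma_r=\sigma_s$; otherwise $\pi$ avoids $\sigma$. Let $c_n(\sigma,\tau,\dots)$ be the number of elements of $\mathcal{C}_n$ that avoid all of the patterns $\sigma,\tau,\dots$. Let $C_n=\frac{1}{n+1}\binom{2n}{n}$ be the $n$th Catalan number, and let $F_n$ be the Fibonacci numbers with the convention $F_0=F_1=1$ and $F_n=F_{n-1}+F_{n-2}$ for $n\ge2$. Theorem. For all $n\ge1$, (a) $c_n(1123,1132)=c_n(1322,3122)=2^{n-1}C_n$; (b) $c_n(1123,1132,2133)=F_nC_n$; (c) $c_n(1123,1132,2331)=c_n(1123,1132,3122)=c_n(1332,2213,2231)=\binom{2n}{n-1}$.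 -/

import Mathlib

/-- Words over `ℕ` (both permutations of multisets and patterns are words). -/
abbrev NWord := List ℕ

/-- `w` contains the pattern `σ`: some subsequence of `w`, at the positions given by a strictly
increasing map `f`, has the same length as `σ` and is in the same relative order as `σ`, with
equal entries exactly where `σ` has equal entries. -/
def NWord.Contains (w σ : NWord) : Prop :=
  ∃ f : Fin σ.length → Fin w.length, StrictMono f ∧
    ∀ r s : Fin σ.length,
      (w.get (f r) < w.get (f s) ↔ σ.get r < σ.get s) ∧
      (w.get (f r) = w.get (f s) ↔ σ.get r = σ.get s)

/-- `w` avoids the pattern `σ`. -/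
def NWord.Avoids (w σ : NWord) : Prop := ¬ NWord.Contains w σ

/-- `w` is a permutation of the multiset `{1, 1, 2, 2, …, n, n}`. -/
def IsDoublePerm (n : ℕ) (w : NWord) : Prop :=
  List.Perm w (List.range' 1 n ++ List.range' 1 n)

/-- The set `𝒞ₙ` of nonnesting permutations of `{1, 1, …, n, n}`: those that avoid `1221` and
`2112`. -/
def nonnestingPerms (n : ℕ) : Set NWord :=
  {w | IsDoublePerm n w ∧ NWord.Avoids w [1, 2, 2, 1] ∧ NWord.Avoids w [2, 1, 1, 2]}

/-- The set `𝒞ₙ(Λ)` of nonnesting permutations avoiding every pattern in `Λ`. -/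
def nonnestingAvoiding (n : ℕ) (Λ : Set NWord) : Set NWord :=
  {w | w ∈ nonnestingPerms n ∧ ∀ σ ∈ Λ, NWord.Avoids w σ}

/-- `𝒞ₙ(Λ)` is finite, so that its `Set.ncard` is its genuine cardinality. -/
theorem nonnestingAvoiding_finite (n : ℕ) (Λ : Set NWord) : (nonnestingAvoiding n Λ).Finite := by
  refine ((List.range' 1 n ++ List.range' 1 n).permutations.toFinset.finite_toSet).subset ?_
  intro w hw
  simpa [IsDoublePerm] using hw.1.1

/-- The number `cₙ(Λ)` of nonnesting permutations avoiding every pattern in `Λ`. -/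
noncomputable def nonnestingCount (n : ℕ) (Λ : Set NWord) : ℕ :=
  (nonnestingAvoiding n Λ).ncard

/-- The Fibonacci numbers with the convention `F₀ = F₁ = 1`. -/
def shiftedFib (n : ℕ) : ℕ := Nat.fib (n + 1)

/-! In a nonnesting permutation the second copies appear in the same order as the first copies. The
word is therefore determined by that common order `l`, a permutation of `1, …, n`, together with the
Dyck path `d` that marks each position as a first copy (`U`) or a second copy (`D`). Conversely
every such pair gives a nonnesting permutation: a first copy enters a queue, and a second copy
leaves it at the front. `FifoTrace` is this correspondence.

The patterns considered here only see `l`. If `l` contains the subsequence `abc`, then `w` contains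
each of `aabc`, `abbc` and `abcc` (`double`). In the other direction, `aab` or `abb` in `w` forces
`a` before `b` in `l` (`pair_of_aab`, `pair_of_abb`). So `abbc` recovers `abc` exactly, while `aabc`
recovers it up to exchanging `b` and `c`, and `abcc` up to exchanging `a` and `b`. Each set of
patterns in the theorem is closed under this ambiguity, so avoiding it amounts to `l` avoiding a set
of patterns of length three.

By `nonnestingCount_eq` the count is then the Catalan number times a number of permutations of
Simion–Schmidt type: `2 ^ (n - 1)`, a Fibonacci number, or `n`. These are found by asking which
letters can come first; arbitrary finite sets of letters are allowed so that the induction can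
delete the head. -/

open List DyckStep

/-! ### Words produced by a queue -/

/-- `FifoTrace q d l w`: starting from the queue `q`, the steps `d` (`U` pushes the next letter of
`l`, `D` pops the oldest letter) end with the empty queue, exhaust `l`, and process the letters of
`w` in this order. -/
inductive FifoTrace : List ℕ → List DyckStep → List ℕ → List ℕ → Prop
  | nil : FifoTrace [] [] [] []
  | push {q d l w} (a : ℕ) : FifoTrace (q ++ [a]) d l w → FifoTrace q (U :: d) (a :: l) (a :: w)
  | pop {q d l w} (b : ℕ) : FifoTrace q d l w → FifoTrace (b :: q) (D :: d) l (b :: w)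

namespace FifoTrace

variable {q l w : List ℕ} {d : List DyckStep}

/-- A letter in the queue has one copy still to come, a letter of `l` both. -/
theorem count_eq (h : FifoTrace q d l w) (x : ℕ) : w.count x = q.count x + 2 * l.count x := by
  induction h with
  | nil => simp
  | push a h ih => simp only [count_cons, count_append, count_nil] at *; split_ifs at * <;> omega
  | pop b h ih => simp only [count_cons] at *; split_ifs at * <;> omega

theorem mem_iff (h : FifoTrace q d l w) (x : ℕ) : x ∈ w ↔ x ∈ q ++ l := by
  rw [← count_pos_iff, ← count_pos_iff, h.count_eq, count_append]
  omega

/-- The popped letters alone spell `q ++ l`. -/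
theorem sublist (h : FifoTrace q d l w) : q ++ l <+ w := by
  induction h with
  | nil => simp
  | push a h ih => simpa using ih.cons a
  | pop b h ih => simpa using ih

/-- Take `u` and `x` as first copies, then `x` and `v` as second copies: when `x` is popped, `u` and
`x` have been pushed, and `v` is popped later. Prepending `q` to `w` restores the first copies
written before the trace starts, which makes the statement inductive. -/
theorem double (h : FifoTrace q d l w) {u v : List ℕ} {x : ℕ} (hs : u ++ x :: v <+ q ++ l) :
    u ++ x :: x :: v <+ q ++ w := by
  induction h generalizing u with
  | nil => simp at hs
  | push a h ih => simpa using ih (u := u) (by simpa using hs)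
  | @pop q d l w b h ih =>
    have hsub : q ++ w <+ b :: q ++ b :: w := by simp
    cases u with
    | nil =>
      rw [nil_append, cons_append, cons_sublist_cons'] at hs
      rcases hs with hs | ⟨rfl, hs⟩
      · exact (ih (u := []) hs).trans hsub
      · have h1 : x :: v <+ x :: w := (hs.trans h.sublist).cons_cons x
        simpa using h1.trans (sublist_append_right q _)
    | cons y u =>
      rw [cons_append, cons_append, cons_sublist_cons'] at hs
      rcases hs with hs | ⟨rfl, hs⟩
      · exact (ih (u := y :: u) hs).trans hsub
      · simpa using (ih hs).trans (Sublist.append_left (sublist_cons_self y w) q)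

theorem sublist_of_ne (b : ℕ) {t u v : List ℕ} (hb : b ∉ t) (h : t <+ b :: u ++ b :: v) :
    t <+ u ++ v := by
  have := h.filter (fun x => x ≠ b)
  rw [filter_eq_self.2 (by rintro x hx; simp; rintro rfl; exact hb hx)] at this
  simp only [cons_append, ne_eq, decide_not, decide_true, Bool.not_true, Bool.false_eq_true,
    not_false_eq_true, filter_cons_of_neg, filter_append] at this
  exact this.trans ((filter_sublist).append filter_sublist)

/-- A `b` written after the second `a` is, or is followed by, the second `b`; hence `a` leaves the
queue before `b`, and so entered it before `b`. -/
theorem pair_of_aab (h : FifoTrace q d l w) (hn : (q ++ l).Nodup) {a b : ℕ} (hab : a ≠ b)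
    (hs : [a, a, b] <+ q ++ w) : [a, b] <+ q ++ l := by
  induction h with
  | nil => simp at hs
  | push c h ih => simpa using ih (by simpa using hn) (by simpa using hs)
  | @pop q d l w c h ih =>
    have hn' : (q ++ l).Nodup := (nodup_cons.1 hn).2
    have hc : c ∉ q ++ l := (nodup_cons.1 hn).1
    rcases eq_or_ne c a with rfl | hca
    · have hb : b ∈ c :: q ++ c :: w := hs.subset (by simp)
      have hb' : b ∈ q ++ l := by
        have := h.mem_iff b
        simp only [cons_append, mem_cons, mem_append] at hb this ⊢
        grind
      simpa using hb'
    rcases eq_or_ne c b with rfl | hcb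
    · exfalso
      have hcw : c ∉ w := fun hw => hc ((h.mem_iff c).1 hw)
      have h1 : [a, a, c] <+ q ++ c :: w := by
        rw [cons_append, cons_sublist_cons'] at hs
        rcases hs with hs | ⟨rfl, -⟩
        · exact hs
        · exact absurd rfl hab
      have h2 : [c, a, a] <+ w.reverse ++ c :: q.reverse := by simpa using h1.reverse
      have h3 : [a, a] <+ q.reverse := by
        have key : ∀ r : List ℕ, c ∉ r → [c, a, a] <+ r ++ c :: q.reverse → [a, a] <+ q.reverse := by
          intro r
          induction r with
          | nil =>
            intro _ hh
            rw [nil_append, cons_sublist_cons'] at hh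
            rcases hh with hh | hh
            · exact absurd (hh.subset (by simp : c ∈ _)) (by simp at hc ⊢; exact hc.1)
            · exact hh.2
          | cons y r ihr =>
            intro hy hh
            rw [cons_append, cons_sublist_cons'] at hh
            rcases hh with hh | ⟨rfl, -⟩
            · exact ihr (by simp at hy; exact hy.2) hh
            · simp at hy
        exact key _ (by simpa using hcw) h2
      have h4 : [a, a] <+ q := by simpa using h3.reverse
      have := (hn'.sublist (sublist_append_left q l)).sublist h4
      simp at this
    · exact (ih hn' (sublist_of_ne c (by simp [hca, hcb]) hs)).trans (by simp)

/-- If `b` were popped while `a` is still in play, the copy of `b` at the front of the queue would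
precede every remaining `a`, leaving a single `b` to follow. -/
theorem pair_of_abb (h : FifoTrace q d l w) (hn : (q ++ l).Nodup) {a b : ℕ} (hab : a ≠ b)
    (hs : [a, b, b] <+ q ++ w) : [a, b] <+ q ++ l := by
  induction h with
  | nil => simp at hs
  | push c h ih => simpa using ih (by simpa using hn) (by simpa using hs)
  | @pop q d l w c h ih =>
    have hn' : (q ++ l).Nodup := (nodup_cons.1 hn).2
    have hc : c ∉ q ++ l := (nodup_cons.1 hn).1
    rcases eq_or_ne c a with rfl | hca
    · have hb : b ∈ c :: q ++ c :: w := hs.subset (by simp)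
      have hb' : b ∈ q ++ l := by
        have := h.mem_iff b
        simp only [cons_append, mem_cons, mem_append] at hb this ⊢
        grind
      simpa using hb'
    rcases eq_or_ne c b with rfl | hcb
    · exfalso
      have hcw : c ∉ w := fun hw => hc ((h.mem_iff c).1 hw)
      rw [cons_append, cons_sublist_cons'] at hs
      rcases hs with hs | ⟨rfl, -⟩
      · have h1 := hs.count_le c
        have hq : c ∉ q := fun hq => hc (mem_append_left _ hq)
        simp [hab, count_eq_zero.2 hcw, count_eq_zero.2 hq] at h1
      · exact absurd rfl hab
    · exact (ih hn' (sublist_of_ne c (by simp [hca, hcb]) hs)).trans (by simp)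

/-- The word dictates each step: the next letter is popped if it heads the queue, and otherwise
pushed. Absence of repetition in `q ++ l` excludes any conflict. -/
theorem unique {d' l' : List _} (h : FifoTrace q d l w) (h' : FifoTrace q d' l' w)
    (hn : (q ++ l).Nodup) (hn' : (q ++ l').Nodup) : d = d' ∧ l = l' := by
  induction h generalizing d' l' with
  | nil => cases h'; simp
  | push a h ih =>
    cases h' with
    | push _ h' =>
      have := ih h' (by simpa using hn) (by simpa using hn')
      simp [this]
    | pop _ h' => simp at hn
  | pop a h ih =>
    cases h' with
    | push _ h' => simp at hn'
    | pop _ h' =>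
      have := ih h' (nodup_cons.1 hn).2 (nodup_cons.1 hn').2
      simp [this]

theorem functional {w' : List ℕ} (h : FifoTrace q d l w) (h' : FifoTrace q d l w') : w = w' := by
  induction h generalizing w' with
  | nil => cases h'; rfl
  | push a h ih => cases h' with | push _ h' => rw [ih h']
  | pop a h ih => cases h' with | pop _ h' => rw [ih h']

theorem length_eq (h : FifoTrace q d l w) : d.count U = l.length := by
  induction h <;> simp_all

theorem balanced (h : FifoTrace q d l w) : q.length + d.count U = d.count D := by
  induction h with
  | nil => simp
  | push a h ih => simp at *; omega
  | pop a h ih => simp at *; omega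

theorem prefix_le (h : FifoTrace q d l w) (i : ℕ) :
    (d.take i).count D ≤ q.length + (d.take i).count U := by
  induction h generalizing i with
  | nil => simp
  | push a h ih =>
    cases i with
    | zero => simp
    | succ i => have := ih i; simp at *; omega
  | pop a h ih =>
    cases i with
    | zero => simp
    | succ i => have := ih i; simp at *; omega

/-- The hypotheses say that `d` descends from height `q.length` to `0` without going below `0`, so a
pop never meets an empty queue. -/
theorem exists_word (d : List DyckStep) (q l : List ℕ) (hl : d.count U = l.length)
    (hb : q.length + d.count U = d.count D)
    (hp : ∀ i, (d.take i).count D ≤ q.length + (d.take i).count U) :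
    ∃ w, FifoTrace q d l w := by
  induction d generalizing q l with
  | nil =>
    obtain rfl : l = [] := by simpa using hl.symm
    obtain rfl : q = [] := by simpa using hb
    exact ⟨_, nil⟩
  | cons s d ih =>
    cases s with
    | U =>
      cases l with
      | nil => simp at hl
      | cons a l =>
        obtain ⟨w, hw⟩ := ih (q ++ [a]) l (by simpa using hl) (by simp at *; omega)
          (fun i => by have := hp (i + 1); simp at *; omega)
        exact ⟨_, hw.push a⟩
    | D =>
      cases q with
      | nil => have := hp 1; simp at this
      | cons b q =>
        obtain ⟨w, hw⟩ := ih q l (by simpa using hl) (by simp at *; omega)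
          (fun i => by have := hp (i + 1); simp at *; omega)
        exact ⟨_, hw.pop b⟩

theorem exists_of_nonnesting (w q : List ℕ) (hq : q.Nodup)
    (hc : ∀ x ∈ q ++ w, (q ++ w).count x = 2)
    (hN : ∀ a b, a ≠ b → ¬ [a, b, b, a] <+ q ++ w) : ∃ d l, FifoTrace q d l w := by
  induction w generalizing q with
  | nil =>
    cases q with
    | nil => exact ⟨_, _, nil⟩
    | cons b q =>
      have h1 := hc b (by simp)
      have h2 := nodup_iff_count_le_one.1 hq b
      simp at h1 h2
      omega
  | cons a w ih =>
    by_cases ha : a ∈ q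
    · cases q with
      | nil => simp at ha
      | cons b q =>
        obtain ⟨hbq, hq'⟩ := nodup_cons.1 hq
        rcases eq_or_ne a b with rfl | hab
        · obtain ⟨d, l, h⟩ := ih q hq'
            (fun x hx => by
              have h0 := hc x (by simp at hx ⊢; tauto)
              have h1 := hc a (by simp)
              have h2 := count_pos_iff.2 hx
              simp only [count_append, count_cons, cons_append] at h0 h1 h2 ⊢
              by_cases hxa : a = x
              · subst hxa; simp at h0; omega
              · simp [hxa] at h0; omega)
            (fun c e hce hs => hN c e hce (hs.trans (by simp)))
          exact ⟨_, _, h.pop a⟩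
        -- The letter `a` is in the queue behind its front `b`, whose second copy is still to come:
        -- this is the nesting `b a a b`.
        · exfalso
          have haq : a ∈ q := by simpa [hab] using ha
          have hbw : b ∈ w := by
            have h1 := hc b (by simp)
            rw [← count_pos_iff]
            simp [hab, count_eq_zero.2 hbq] at h1
            omega
          apply hN b a hab.symm
          simp only [cons_append, cons_sublist_cons]
          exact (singleton_sublist.2 haq).append ((singleton_sublist.2 hbw).cons_cons a)
    · obtain ⟨d, l, h⟩ := ih (q ++ [a]) (by
          rw [nodup_append]; refine ⟨hq, by simp, ?_⟩
          rintro x hx y hy rfl; simp at hy; exact ha (hy ▸ hx))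
        (by simpa using hc) (by simpa using hN)
      exact ⟨_, _, h.push a⟩

end FifoTrace

/-! ### Arrangements of a finite set and forbidden triples -/

/-- No three letters at increasing positions of the word are related by `R`. -/
def AvoidsTriple (R : ℕ → ℕ → ℕ → Prop) (l : List ℕ) : Prop :=
  ∀ a b c, [a, b, c] <+ l → ¬ R a b c

theorem avoidsTriple_cons {R : ℕ → ℕ → ℕ → Prop} {x : ℕ} {l : List ℕ} :
    AvoidsTriple R (x :: l) ↔ AvoidsTriple R l ∧ ∀ b c, [b, c] <+ l → ¬ R x b c := by
  constructor
  · intro h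
    exact ⟨fun a b c hs => h a b c (hs.cons x), fun b c hs => h x b c (hs.cons_cons x)⟩
  · rintro ⟨h1, h2⟩ a b c hs
    rw [cons_sublist_cons'] at hs
    rcases hs with hs | ⟨rfl, hs⟩
    · exact h1 a b c hs
    · exact h2 b c hs

theorem avoidsTriple_reverse {R : ℕ → ℕ → ℕ → Prop} {l : List ℕ} :
    AvoidsTriple R l.reverse ↔ AvoidsTriple (fun a b c => R c b a) l := by
  constructor
  · intro h a b c hs
    exact h c b a (by simpa using hs.reverse)
  · intro h a b c hs
    exact h c b a (by simpa using hs.reverse)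

theorem pair_or_pair {b c : ℕ} (hbc : b ≠ c) {l : List ℕ} (hb : b ∈ l) (hc : c ∈ l) :
    [b, c] <+ l ∨ [c, b] <+ l := by
  induction l with
  | nil => simp at hb
  | cons x l ih =>
    simp only [cons_sublist_cons', singleton_sublist, mem_cons] at *
    grind

theorem triple_or_triple_of_left {a b c : ℕ} (hbc : b ≠ c) {l : List ℕ} (hb : [a, b] <+ l)
    (hc : [a, c] <+ l) : [a, b, c] <+ l ∨ [a, c, b] <+ l := by
  induction l with
  | nil => simp at hb
  | cons x l ih =>
    have hp := pair_or_pair hbc (l := l)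
    have h1 : ∀ y, [a, y] <+ l → y ∈ l := fun y h => h.subset (by simp)
    rw [cons_sublist_cons', singleton_sublist] at hb hc
    rw [cons_sublist_cons', cons_sublist_cons' (a := a)]
    grind

theorem triple_or_triple_of_right {a b c : ℕ} (hab : a ≠ b) {l : List ℕ} (ha : [a, c] <+ l)
    (hb : [b, c] <+ l) : [a, b, c] <+ l ∨ [b, a, c] <+ l := by
  have := triple_or_triple_of_left hab (l := l.reverse) (a := c) (by simpa using ha.reverse)
    (by simpa using hb.reverse)
  rcases this with h | h
  · exact Or.inr (by simpa using h.reverse)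
  · exact Or.inl (by simpa using h.reverse)

/-- Without repetitions both pairs use the same occurrence of `b`. -/
theorem triple_of_pairs {a b c : ℕ} {l : List ℕ} (hn : l.Nodup) (h1 : [a, b] <+ l)
    (h2 : [b, c] <+ l) : [a, b, c] <+ l := by
  induction l with
  | nil => simp at h1
  | cons x l ih =>
    have h3 : [a, b] <+ l → b ∈ l := fun h => h.subset (by simp)
    rw [nodup_cons] at hn
    rw [cons_sublist_cons'] at h1 h2 ⊢
    rw [singleton_sublist] at h1 h2
    grind

/-- The words in which every element of `S`, and no other letter, occurs exactly once. -/
def arrangements (S : Finset ℕ) : Set (List ℕ) := {l | l.Nodup ∧ l.toFinset = S}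

theorem arrangements_finite (S : Finset ℕ) : (arrangements S).Finite := by
  refine (S.toList.permutations.toFinset.finite_toSet).subset ?_
  rintro l ⟨h1, rfl⟩
  simpa using (perm_of_nodup_nodup_toFinset_eq h1 (Finset.nodup_toList _) (by simp))

theorem mem_iff_of_mem_arrangements {S : Finset ℕ} {l : List ℕ} (h : l ∈ arrangements S) (x : ℕ) :
    x ∈ l ↔ x ∈ S := by
  rw [← h.2]; simp

theorem cons_mem_arrangements {S : Finset ℕ} {x : ℕ} {l : List ℕ} :
    x :: l ∈ arrangements S ↔ x ∈ S ∧ l ∈ arrangements (S.erase x) := by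
  simp only [arrangements, Set.mem_ofPred_eq, nodup_cons, toFinset_cons]
  constructor
  · rintro ⟨⟨h1, h2⟩, rfl⟩
    refine ⟨by simp, h2, ?_⟩
    rw [Finset.erase_insert (by simpa using h1)]
  · rintro ⟨h1, h2, h3⟩
    refine ⟨⟨?_, h2⟩, ?_⟩
    · rw [← mem_toFinset, h3]; simp
    · rw [h3, Finset.insert_erase h1]

theorem reverse_mem_arrangements {S : Finset ℕ} {l : List ℕ} :
    l.reverse ∈ arrangements S ↔ l ∈ arrangements S := by
  simp [arrangements]

/-- The number of arrangements of `S` satisfying `P`. -/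
noncomputable def arrangementCount (P : List ℕ → Prop) (S : Finset ℕ) : ℕ :=
  {l | l ∈ arrangements S ∧ P l}.ncard

theorem arrangementCount_congr {P Q : List ℕ → Prop} {S : Finset ℕ}
    (h : ∀ l ∈ arrangements S, (P l ↔ Q l)) : arrangementCount P S = arrangementCount Q S := by
  unfold arrangementCount
  congr 1
  ext l
  exact and_congr_right (h l)

theorem arrangementCount_reverse (R : ℕ → ℕ → ℕ → Prop) (S : Finset ℕ) :
    arrangementCount (AvoidsTriple fun a b c => R c b a) S
      = arrangementCount (AvoidsTriple R) S := by
  unfold arrangementCount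
  rw [← Set.ncard_image_of_injective _ (reverse_injective (α := ℕ))]
  congr 1
  ext l
  rw [Set.mem_image]
  constructor
  · rintro ⟨k, ⟨h1, h2⟩, rfl⟩
    exact ⟨reverse_mem_arrangements.2 h1, avoidsTriple_reverse.2 h2⟩
  · rintro ⟨h1, h2⟩
    exact ⟨l.reverse, ⟨reverse_mem_arrangements.2 h1, avoidsTriple_reverse.2 h2⟩, by simp⟩

theorem arrangementCount_eq_one {P : List ℕ → Prop} {S : Finset ℕ} {l₀ : List ℕ}
    (h₀ : l₀ ∈ arrangements S) (h : ∀ l ∈ arrangements S, (P l ↔ l = l₀)) :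
    arrangementCount P S = 1 := by
  unfold arrangementCount
  rw [Set.ncard_eq_one]
  refine ⟨l₀, ?_⟩
  ext l
  constructor
  · rintro ⟨h1, h2⟩; exact (h l h1).1 h2
  · rintro rfl; exact ⟨h₀, (h _ h₀).2 rfl⟩

theorem arrangementCount_image_cons {P : List ℕ → Prop} {S : Finset ℕ} {x : ℕ} (hx : x ∈ S) :
    {l | l ∈ arrangements S ∧ P l ∧ l.head? = some x}.ncard
      = arrangementCount (fun l => P (x :: l)) (S.erase x) := by
  refine Eq.trans ?_ (Set.ncard_image_of_injective _ (cons_injective (a := x)))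
  congr 1
  ext l
  rw [Set.mem_image]
  constructor
  · rintro ⟨h1, h2, h3⟩
    cases l with
    | nil => simp at h3
    | cons y l =>
      obtain rfl : y = x := by simpa using h3
      exact ⟨l, ⟨(cons_mem_arrangements.1 h1).2, h2⟩, rfl⟩
  · rintro ⟨k, ⟨h1, h2⟩, rfl⟩
    exact ⟨cons_mem_arrangements.2 ⟨hx, h1⟩, h2, rfl⟩

/-- Splits by the head when `P` leaves only two possible heads. -/
theorem arrangementCount_eq_add {P : List ℕ → Prop} {S : Finset ℕ} {x y : ℕ} (hx : x ∈ S)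
    (hy : y ∈ S) (hxy : x ≠ y)
    (h : ∀ z ∈ S, ∀ l ∈ arrangements (S.erase z), P (z :: l) → z = x ∨ z = y) :
    arrangementCount P S = arrangementCount (fun l => P (x :: l)) (S.erase x)
      + arrangementCount (fun l => P (y :: l)) (S.erase y) := by
  rw [← arrangementCount_image_cons hx, ← arrangementCount_image_cons hy,
    ← Set.ncard_union_eq ?_ ((arrangements_finite S).subset fun l hl => hl.1)
      ((arrangements_finite S).subset fun l hl => hl.1)]
  · unfold arrangementCount
    congr 1
    ext l
    constructor
    · rintro ⟨h1, h2⟩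
      cases l with
      | nil => rw [← h1.2] at hx; simp at hx
      | cons z l =>
        have h3 := cons_mem_arrangements.1 h1
        rcases h z h3.1 l h3.2 h2 with rfl | rfl
        · exact Or.inl ⟨h1, h2, rfl⟩
        · exact Or.inr ⟨h1, h2, rfl⟩
    · rintro (⟨h1, h2, -⟩ | ⟨h1, h2, -⟩) <;> exact ⟨h1, h2⟩
  · rw [Set.disjoint_left]
    rintro l ⟨-, -, h1⟩ ⟨-, -, h2⟩
    rw [h1] at h2
    exact hxy (by simpa using h2)

theorem arrangementCount_eq_of_head {P : List ℕ → Prop} {S : Finset ℕ} {x : ℕ} (hx : x ∈ S)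
    (h : ∀ z ∈ S, ∀ l ∈ arrangements (S.erase z), P (z :: l) → z = x) :
    arrangementCount P S = arrangementCount (fun l => P (x :: l)) (S.erase x) := by
  rw [← arrangementCount_image_cons hx]
  unfold arrangementCount
  congr 1
  ext l
  constructor
  · rintro ⟨h1, h2⟩
    cases l with
    | nil => rw [← h1.2] at hx; simp at hx
    | cons z l =>
      have h3 := cons_mem_arrangements.1 h1
      obtain rfl := h z h3.1 l h3.2 h2
      exact ⟨h1, h2, rfl⟩
  · rintro ⟨h1, h2, -⟩
    exact ⟨h1, h2⟩

theorem arrangementCount_of_card_le_one {R : ℕ → ℕ → ℕ → Prop} {S : Finset ℕ} (hS : S.card ≤ 1) :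
    arrangementCount (AvoidsTriple R) S = 1 := by
  have hlen : ∀ l ∈ arrangements S, l.length = S.card := fun l hl => by
    rw [← hl.2, toFinset_card_of_nodup hl.1]
  have h0 : S.toList ∈ arrangements S := ⟨S.nodup_toList, by simp⟩
  refine arrangementCount_eq_one h0 fun l hl => ?_
  constructor
  · intro _
    have h1 := perm_of_nodup_nodup_toFinset_eq hl.1 S.nodup_toList (by rw [hl.2]; simp)
    have h2 := hlen l hl
    match l, h1, h2 with
    | [], h1, _ => simpa using h1
    | [x], h1, _ => exact (singleton_perm.1 h1)
    | x :: y :: l, _, h2 => simp at h2; omega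
  · rintro rfl a b c hs
    have := hs.length_le
    simp at this
    omega

theorem exists_greatest {S : Finset ℕ} (hS : S.Nonempty) : ∃ m ∈ S, ∀ z ∈ S, z ≤ m :=
  ⟨S.max' hS, S.max'_mem hS, fun z hz => S.le_max' z hz⟩

theorem exists_least {S : Finset ℕ} (hS : S.Nonempty) : ∃ m ∈ S, ∀ z ∈ S, m ≤ z :=
  ⟨S.min' hS, S.min'_mem hS, fun z hz => S.min'_le z hz⟩

theorem exists_two_greatest {S : Finset ℕ} (hS : 2 ≤ S.card) :
    ∃ m ∈ S, ∃ x ∈ S, x < m ∧ ∀ z ∈ S, z = m ∨ z ≤ x := by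
  obtain ⟨m, hm, hmax⟩ := exists_greatest (S := S) (Finset.card_pos.1 (by omega))
  obtain ⟨x, hx, hxmax⟩ := exists_greatest (S := S.erase m)
    (Finset.card_pos.1 (by rw [Finset.card_erase_of_mem hm]; omega))
  rw [Finset.mem_erase] at hx
  refine ⟨m, hm, x, hx.2, lt_of_le_of_ne (hmax x hx.2) hx.1, fun z hz => ?_⟩
  by_cases h : z = m
  · exact Or.inl h
  · exact Or.inr (hxmax z (by simp [h, hz]))

theorem exists_least_greatest {S : Finset ℕ} (hS : 2 ≤ S.card) :
    ∃ m ∈ S, ∃ x ∈ S, x < m ∧ (∀ z ∈ S, z ≤ m) ∧ ∀ z ∈ S, x ≤ z := by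
  obtain ⟨m, hm, hmax⟩ := exists_greatest (S := S) (Finset.card_pos.1 (by omega))
  obtain ⟨x, hx, hmin⟩ := exists_least (S := S) (Finset.card_pos.1 (by omega))
  refine ⟨m, hm, x, hx, lt_of_le_of_ne (hmax x hx) ?_, hmax, hmin⟩
  rintro rfl
  have : S ⊆ {x} := fun z hz => by
    have := hmax z hz; have := hmin z hz; simp; omega
  have := Finset.card_le_card this
  simp at this; omega

/-- Two letters of an arrangement of `S` other than its head. -/
theorem pair_spec {S : Finset ℕ} {z : ℕ} {l : List ℕ} (hl : l ∈ arrangements (S.erase z))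
    {b c : ℕ} (h : [b, c] <+ l) : (b ∈ S ∧ b ≠ z) ∧ (c ∈ S ∧ c ≠ z) ∧ b ≠ c := by
  have h1 : b ∈ l := h.subset (by simp)
  have h2 : c ∈ l := h.subset (by simp)
  rw [mem_iff_of_mem_arrangements hl, Finset.mem_erase] at h1 h2
  have h3 := hl.1.sublist h
  simp at h3
  tauto

/-- In one order or the other, two distinct letters of `S` occur behind the head. -/
theorem pair_or_pair_of_arrangement {S : Finset ℕ} {z : ℕ} {l : List ℕ}
    (hl : l ∈ arrangements (S.erase z)) {b c : ℕ} (hb : b ∈ S) (hc : c ∈ S) (hbz : b ≠ z)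
    (hcz : c ≠ z) (hbc : b ≠ c) : [b, c] <+ l ∨ [c, b] <+ l :=
  pair_or_pair hbc (by rw [mem_iff_of_mem_arrangements hl]; simp [hb, hbz])
    (by rw [mem_iff_of_mem_arrangements hl]; simp [hc, hcz])

/-! ### Counts of permutations avoiding sets of patterns of length three -/

/-- The head cannot have two larger letters behind it, so it is one of the two greatest; neither of
these starts a forbidden triple, and the count doubles. -/
theorem count_123_132 (n : ℕ) (S : Finset ℕ) (hS : S.card = n + 1) :
    arrangementCount (AvoidsTriple fun a b c => a < b ∧ a < c) S = 2 ^ n := by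
  induction n generalizing S with
  | zero => exact arrangementCount_of_card_le_one (by omega)
  | succ n ih =>
    obtain ⟨m, hm, x, hx, hxm, hmax⟩ := exists_two_greatest (S := S) (by omega)
    rw [arrangementCount_eq_add hm hx hxm.ne']
    · have e : ∀ y ∈ S, (∀ z ∈ S, z = m ∨ z ≤ x) → (y = m ∨ y = x) →
          arrangementCount (fun l => AvoidsTriple (fun a b c => a < b ∧ a < c) (y :: l))
            (S.erase y) = 2 ^ n := by
        intro y hy _ hyy
        rw [← ih (S.erase y) (by rw [Finset.card_erase_of_mem hy]; omega)]
        refine arrangementCount_congr fun l hl => ?_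
        rw [avoidsTriple_cons, and_iff_left]
        intro b c hbc
        have := pair_spec hl hbc
        have := hmax b (by tauto)
        have := hmax c (by tauto)
        omega
      rw [e m hm hmax (by simp), e x hx hmax (by simp)]; ring
    · intro z hz l hl h
      by_contra! hc
      have := hmax z hz
      rw [avoidsTriple_cons] at h
      rcases pair_or_pair_of_arrangement hl hm hx (by omega) (by omega) (by omega) with h' | h' <;>
        exact h.2 _ _ h' (by omega)

/-- The head cannot lie strictly between two later letters, so it is the least or the greatest, and
either is harmless. -/
theorem count_213_231 (n : ℕ) (S : Finset ℕ) (hS : S.card = n + 1) :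
    arrangementCount (AvoidsTriple fun a b c => (c < a ∧ a < b) ∨ (b < a ∧ a < c)) S = 2 ^ n := by
  induction n generalizing S with
  | zero => exact arrangementCount_of_card_le_one (by omega)
  | succ n ih =>
    obtain ⟨m, hm, x, hx, hxm, hmax, hmin⟩ := exists_least_greatest (S := S) (by omega)
    rw [arrangementCount_eq_add hm hx hxm.ne']
    · have e : ∀ y ∈ S, (y = m ∨ y = x) →
          arrangementCount (fun l => AvoidsTriple
            (fun a b c => (c < a ∧ a < b) ∨ (b < a ∧ a < c)) (y :: l)) (S.erase y) = 2 ^ n := by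
        intro y hy hyy
        rw [← ih (S.erase y) (by rw [Finset.card_erase_of_mem hy]; omega)]
        refine arrangementCount_congr fun l hl => ?_
        rw [avoidsTriple_cons, and_iff_left]
        intro b c hbc
        have hp := pair_spec hl hbc
        have := hmax b hp.1.1
        have := hmax c hp.2.1.1
        have := hmin b hp.1.1
        have := hmin c hp.2.1.1
        omega
      rw [e m hm (by simp), e x hx (by simp)]; ring
    · intro z hz l hl h
      by_contra! hc
      have := hmax z hz
      have := hmin z hz
      rw [avoidsTriple_cons] at h
      rcases pair_or_pair_of_arrangement hl hm hx (by omega) (by omega) (by omega) with h' | h' <;>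
        exact h.2 _ _ h' (by omega)

theorem count_132_312 (n : ℕ) (S : Finset ℕ) (hS : S.card = n + 1) :
    arrangementCount (AvoidsTriple fun a b c => (a < c ∧ c < b) ∨ (b < c ∧ c < a)) S = 2 ^ n := by
  rw [← arrangementCount_reverse, count_213_231 n S hS]

/-- Exactly one arrangement of `S` is sorted with respect to a given linear order. -/
theorem existsUnique_sorted (r : ℕ → ℕ → Prop) [IsTrans ℕ r] [Std.Antisymm r] [Std.Total r]
    (S : Finset ℕ) :
    ∃ l₀ ∈ arrangements S, ∀ l ∈ arrangements S, ((∀ b c, [b, c] <+ l → r b c) ↔ l = l₀) := by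
  classical
  refine ⟨S.sort r, ⟨S.sort_nodup r, S.sort_toFinset r⟩, fun l hl => ?_⟩
  have hp : (S.sort r).Pairwise r := S.pairwise_sort r
  rw [← pairwise_iff_forall_sublist]
  constructor
  · intro h
    exact (perm_of_nodup_nodup_toFinset_eq hl.1 (S.sort_nodup r) (by rw [hl.2]; simp)).eq_of_pairwise
      (fun a b _ _ h1 h2 => antisymm h1 h2) h hp
  · rintro rfl; exact hp

theorem arrangementCount_sorted {P : List ℕ → Prop} {S : Finset ℕ} (r : ℕ → ℕ → Prop)
    [IsTrans ℕ r] [Std.Antisymm r] [Std.Total r]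
    (h : ∀ l ∈ arrangements S, (P l ↔ ∀ b c, [b, c] <+ l → r b c)) :
    arrangementCount P S = 1 := by
  obtain ⟨l₀, h₀, hu⟩ := existsUnique_sorted r S
  exact arrangementCount_eq_one h₀ fun l hl => (h l hl).trans (hu l hl)

theorem arrangementCount_cons_free {R : ℕ → ℕ → ℕ → Prop} {S : Finset ℕ} {x : ℕ}
    (h : ∀ b ∈ S, ∀ c ∈ S, b ≠ x → c ≠ x → b ≠ c → ¬ R x b c) :
    arrangementCount (fun l => AvoidsTriple R (x :: l)) (S.erase x)
      = arrangementCount (AvoidsTriple R) (S.erase x) := by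
  refine arrangementCount_congr fun l hl => ?_
  rw [avoidsTriple_cons, and_iff_left]
  intro b c hbc
  obtain ⟨⟨h1, h2⟩, ⟨h3, h4⟩, h5⟩ := pair_spec hl hbc
  exact h b h1 c h3 h2 h4 h5

/-- The head is the greatest letter `m` or the second greatest `x`. After `m` the rest is free.
After `x` the letter `m` must follow at once, since any `z` between them would give the pattern 213
as `x z m`; what comes after `m` is free. This is the Fibonacci recursion. -/
theorem count_123_132_213 (n : ℕ) (S : Finset ℕ) (hS : S.card = n) :
    arrangementCount (AvoidsTriple fun a b c => (a < b ∧ a < c) ∨ (b < a ∧ a < c)) S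
      = Nat.fib (n + 1) := by
  induction n using Nat.strong_induction_on generalizing S with
  | _ n ih =>
    match n, ih, hS with
    | 0, _, hS => exact arrangementCount_of_card_le_one (by omega)
    | 1, _, hS => exact arrangementCount_of_card_le_one (by omega)
    | n + 2, ih, hS =>
      obtain ⟨m, hm, x, hx, hxm, hmax⟩ := exists_two_greatest (S := S) (by omega)
      have hmx : m ∈ S.erase x := by simp [hm, hxm.ne']
      rw [arrangementCount_eq_add hm hx hxm.ne', arrangementCount_cons_free,
        ih (n + 1) (by omega) (S.erase m) (by rw [Finset.card_erase_of_mem hm]; omega),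
        arrangementCount_eq_of_head hmx, arrangementCount_congr (Q := AvoidsTriple _),
        ih n (by omega) ((S.erase x).erase m)
          (by rw [Finset.card_erase_of_mem hmx, Finset.card_erase_of_mem hx]; omega)]
      · rw [Nat.fib_add_two (n := n + 1), add_comm]
      · intro l hl
        rw [avoidsTriple_cons, avoidsTriple_cons, and_assoc, and_iff_left]
        constructor
        · intro b c hbc
          obtain ⟨⟨h1, h2⟩, ⟨h3, h4⟩, h5⟩ := pair_spec hl hbc
          have := hmax b (Finset.mem_of_mem_erase h1)
          have := hmax c (Finset.mem_of_mem_erase h3)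
          omega
        -- In a pair of `m :: l` the later letter `c` is not `m`, hence lies below `x`, whereas both
        -- forbidden patterns starting at `x` need `c` above `x`.
        · intro b c hbc
          have hl' : m :: l ∈ arrangements (S.erase x) := cons_mem_arrangements.2 ⟨hmx, hl⟩
          obtain ⟨⟨h1, h2⟩, ⟨h3, h4⟩, h5⟩ := pair_spec hl' hbc
          have hcm : c ≠ m := by
            rintro rfl
            rw [cons_sublist_cons'] at hbc
            rcases hbc with hbc | ⟨rfl, -⟩
            · exact (nodup_cons.1 hl'.1).1 (hbc.subset (by simp))
            · exact h5 rfl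
          have := hmax b h1
          have := hmax c h3
          omega
      · intro z hz l hl h
        by_contra hzm
        have hl' : z :: l ∈ arrangements (S.erase x) := cons_mem_arrangements.2 ⟨hz, hl⟩
        rw [avoidsTriple_cons] at h
        have hml : m ∈ l := by
          rw [mem_iff_of_mem_arrangements hl]; simp [hm, hxm.ne', Ne.symm hzm]
        refine h.2 z m ((singleton_sublist.2 hml).cons_cons z) ?_
        have := hmax z (Finset.mem_of_mem_erase hz)
        have := (Finset.mem_erase.1 hz).1
        omega
      · intro b hb c hc _ _ _
        have := hmax b hb
        have := hmax c hc
        omega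
      · intro z hz l hl h
        by_contra! hc
        have := hmax z hz
        rw [avoidsTriple_cons] at h
        rcases pair_or_pair_of_arrangement hl hm hx (by omega) (by omega) (by omega) with h' | h' <;>
          exact h.2 _ _ h' (by omega)

/-- After the greatest letter `m` the rest is free. After the second greatest `x` only one
arrangement survives, so the count grows by one. -/
theorem count_123_132_231 (n : ℕ) (S : Finset ℕ) (hS : S.card = n + 1) :
    arrangementCount (AvoidsTriple fun a b c => (a < b ∧ a < c) ∨ (c < a ∧ a < b)) S = n + 1 := by
  induction n generalizing S with
  | zero => exact arrangementCount_of_card_le_one (by omega)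
  | succ n ih =>
    obtain ⟨m, hm, x, hx, hxm, hmax⟩ := exists_two_greatest (S := S) (by omega)
    rw [arrangementCount_eq_add hm hx hxm.ne', arrangementCount_cons_free,
      ih (S.erase m) (by rw [Finset.card_erase_of_mem hm]; omega)]
    · congr 1
      -- The order of the only arrangement behind `x`: decreasing, with `m` at the end. A letter
      -- after `m` would give 231 with `x` and `m`; an ascent before `m` would give 123 with `m`.
      let r : ℕ → ℕ → Prop := fun b c => c = m ∨ (b ≠ m ∧ c ≤ b)
      have : IsTrans ℕ r := ⟨fun a b c => by simp only [r]; omega⟩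
      have : Std.Antisymm r := ⟨fun a b => by simp only [r]; omega⟩
      have : Std.Total r := ⟨fun a b => by simp only [r]; omega⟩
      refine arrangementCount_sorted r fun l hl => ?_
      rw [avoidsTriple_cons]
      constructor
      · rintro ⟨h1, h2⟩ b c hbc
        have hp := pair_spec hl hbc
        have hb := hmax b hp.1.1
        have hc := hmax c hp.2.1.1
        by_contra hr
        simp only [r] at hr
        have hbm : b ≠ m := fun hbm => h2 b c hbc (by omega)
        rcases pair_or_pair_of_arrangement hl hp.1.1 hm hp.1.2 hxm.ne' hbm with h | h
        · rcases triple_or_triple_of_left (by omega) hbc h with h' | h'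
          · exact h1 _ _ _ h' (by omega)
          · exact h1 _ _ _ h' (by omega)
        · exact h2 m b h (by omega)
      · intro h
        refine ⟨fun a b c habc => ?_, fun b c hbc => ?_⟩
        · have h1 := h a b (Sublist.trans (by simp) habc)
          have h2 := h a c (Sublist.trans (by simp) habc)
          have h3 := h b c (Sublist.trans (by simp) habc)
          have h4 : [b, c] <+ l := Sublist.trans (by simp) habc
          have := (pair_spec hl h4).2.2
          simp only [r] at h1 h2 h3
          omega
        · have h1 := h b c hbc
          have hp := pair_spec hl hbc
          have := hmax b hp.1.1
          have := hmax c hp.2.1.1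
          simp only [r] at h1
          omega
    · intro b hb c hc _ _ _
      have := hmax b hb
      have := hmax c hc
      omega
    · intro z hz l hl h
      by_contra! hc
      have := hmax z hz
      rw [avoidsTriple_cons] at h
      rcases pair_or_pair_of_arrangement hl hm hx (by omega) (by omega) (by omega) with h' | h' <;>
        exact h.2 _ _ h' (by omega)

/-- The head is extreme. After the least letter the rest is free; after the greatest it must
increase, to avoid 321. -/
theorem count_321_231_213 (n : ℕ) (S : Finset ℕ) (hS : S.card = n + 1) :
    arrangementCount (AvoidsTriple fun a b c => (c < b ∧ c < a) ∨ (b < a ∧ a < c)) S = n + 1 := by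
  induction n generalizing S with
  | zero => exact arrangementCount_of_card_le_one (by omega)
  | succ n ih =>
    obtain ⟨m, hm, x, hx, hxm, hmax, hmin⟩ := exists_least_greatest (S := S) (by omega)
    rw [arrangementCount_eq_add hx hm hxm.ne, arrangementCount_cons_free,
      ih (S.erase x) (by rw [Finset.card_erase_of_mem hx]; omega)]
    · congr 1
      refine arrangementCount_sorted (· ≤ ·) fun l hl => ?_
      rw [avoidsTriple_cons]
      constructor
      · rintro ⟨h1, h2⟩ b c hbc
        have hp := pair_spec hl hbc
        have hb := hmax b hp.1.1
        have hc := hmax c hp.2.1.1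
        by_contra hr
        exact h2 b c hbc (by omega)
      · intro h
        refine ⟨fun a b c habc => ?_, fun b c hbc => ?_⟩
        · have h1 := h a b (Sublist.trans (by simp) habc)
          have h2 := h a c (Sublist.trans (by simp) habc)
          have h3 := h b c (Sublist.trans (by simp) habc)
          omega
        · have h1 := h b c hbc
          have hp := pair_spec hl hbc
          have := hmax b hp.1.1
          have := hmax c hp.2.1.1
          omega
    · intro b hb c hc _ _ _
      have := hmin b hb
      have := hmin c hc
      omega
    · intro z hz l hl h
      by_contra! hc
      have := hmax z hz
      have := hmin z hz
      rw [avoidsTriple_cons] at h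
      rcases pair_or_pair_of_arrangement hl hm hx (by omega) (by omega) (by omega) with h' | h' <;>
        exact h.2 _ _ h' (by omega)

theorem count_123_132_312 (n : ℕ) (S : Finset ℕ) (hS : S.card = n + 1) :
    arrangementCount (AvoidsTriple fun a b c => (a < b ∧ a < c) ∨ (b < c ∧ c < a)) S = n + 1 := by
  rw [← arrangementCount_reverse, count_321_231_213 n S hS]

/-- The head is extreme. After the greatest letter the rest is free; after the least it must
increase, to avoid 132. -/
theorem count_132_213_231 (n : ℕ) (S : Finset ℕ) (hS : S.card = n + 1) :
    arrangementCount (AvoidsTriple fun a b c =>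
      (a < c ∧ c < b) ∨ (b < a ∧ a < c) ∨ (c < a ∧ a < b)) S = n + 1 := by
  induction n generalizing S with
  | zero => exact arrangementCount_of_card_le_one (by omega)
  | succ n ih =>
    obtain ⟨m, hm, x, hx, hxm, hmax, hmin⟩ := exists_least_greatest (S := S) (by omega)
    rw [arrangementCount_eq_add hm hx hxm.ne', arrangementCount_cons_free,
      ih (S.erase m) (by rw [Finset.card_erase_of_mem hm]; omega)]
    · congr 1
      refine arrangementCount_sorted (· ≤ ·) fun l hl => ?_
      rw [avoidsTriple_cons]
      constructor
      · rintro ⟨h1, h2⟩ b c hbc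
        have hp := pair_spec hl hbc
        have hb := hmin b hp.1.1
        have hc := hmin c hp.2.1.1
        by_contra hr
        exact h2 b c hbc (by omega)
      · intro h
        refine ⟨fun a b c habc => ?_, fun b c hbc => ?_⟩
        · have h1 := h a b (Sublist.trans (by simp) habc)
          have h2 := h a c (Sublist.trans (by simp) habc)
          have h3 := h b c (Sublist.trans (by simp) habc)
          omega
        · have h1 := h b c hbc
          have hp := pair_spec hl hbc
          have := hmin b hp.1.1
          have := hmin c hp.2.1.1
          omega
    · intro b hb c hc _ _ _
      have := hmax b hb
      have := hmax c hc
      omega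
    · intro z hz l hl h
      by_contra! hc
      have := hmax z hz
      have := hmin z hz
      rw [avoidsTriple_cons] at h
      rcases pair_or_pair_of_arrangement hl hm hx (by omega) (by omega) (by omega) with h' | h' <;>
        exact h.2 _ _ h' (by omega)

/-! ### Pattern containment in terms of subsequences -/

theorem NWord.contains_of_sublist {w σ : NWord} (v : ℕ → ℕ)
    (hv : ∀ r ∈ σ, ∀ s ∈ σ, r < s → v r < v s) (hs : σ.map v <+ w) : NWord.Contains w σ := by
  obtain ⟨f, hf⟩ := sublist_iff_exists_fin_orderEmbedding_get_eq.1 hs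
  refine ⟨fun i => f (i.cast (by simp)), fun i j hij => f.strictMono (by simpa using hij),
    fun r s => ?_⟩
  have hget : ∀ i : Fin σ.length, w.get (f (i.cast (by simp))) = v (σ.get i) := fun i => by
    rw [← hf]; simp
  rw [hget, hget]
  have h1 := hv _ (σ.get_mem r) _ (σ.get_mem s)
  have h2 := hv _ (σ.get_mem s) _ (σ.get_mem r)
  rcases lt_trichotomy (σ.get r) (σ.get s) with h | h | h
  · have := h1 h; omega
  · rw [h]; simp
  · have := h2 h; omega

theorem NWord.Contains.exists_sublist {w σ : NWord} (h : NWord.Contains w σ) :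
    ∃ v : ℕ → ℕ, (∀ r ∈ σ, ∀ s ∈ σ, r < s → v r < v s) ∧ σ.map v <+ w := by
  obtain ⟨f, hf, hrs⟩ := h
  classical
  -- The choice of position is immaterial, as equal letters of the pattern sit on equal letters of
  -- the word; the value `0` off the pattern is never used.
  let v : ℕ → ℕ := fun x => if h : ∃ i, σ.get i = x then w.get (f h.choose) else 0
  have hv : ∀ i, v (σ.get i) = w.get (f i) := fun i => by
    have hex : ∃ j, σ.get j = σ.get i := ⟨i, rfl⟩
    simp only [v]
    rw [dif_pos hex]
    exact (hrs _ _).2.2 hex.choose_spec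
  refine ⟨v, ?_, ?_⟩
  · intro r hr s hs hlt
    obtain ⟨i, rfl⟩ := mem_iff_get.1 hr
    obtain ⟨j, rfl⟩ := mem_iff_get.1 hs
    rw [hv, hv]
    exact (hrs i j).1.2 hlt
  · rw [sublist_iff_exists_fin_orderEmbedding_get_eq]
    refine ⟨OrderEmbedding.ofStrictMono (fun i => f (i.cast (by simp)))
      fun i j hij => hf (by simpa using hij), fun i => ?_⟩
    refine Eq.trans ?_ (hv (i.cast (by simp)))
    simp

theorem NWord.avoids_iff {w σ : NWord} : NWord.Avoids w σ ↔
    ∀ v : ℕ → ℕ, (∀ r ∈ σ, ∀ s ∈ σ, r < s → v r < v s) → ¬ σ.map v <+ w :=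
  ⟨fun h v hv hs => h (NWord.contains_of_sublist v hv hs), fun h hc => by
    obtain ⟨v, hv, hs⟩ := hc.exists_sublist
    exact h v hv hs⟩

/-- The letter `i` of a pattern on `1, 2, 3` plays the role of `a`, `b`, `c` respectively. -/
def threeLetters (a b c : ℕ) (i : ℕ) : ℕ := if i ≤ 1 then a else if i ≤ 2 then b else c

theorem forall_threeLetters {p : ℕ → ℕ → ℕ → Prop} :
    (∀ v : ℕ → ℕ, v 1 < v 2 → v 2 < v 3 → p (v 1) (v 2) (v 3)) ↔
      ∀ a b c, a < b → b < c → p a b c :=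
  ⟨fun h a b c => h (threeLetters a b c), fun h _ => h _ _ _⟩

theorem forall_twoLetters {p : ℕ → ℕ → Prop} :
    (∀ v : ℕ → ℕ, v 1 < v 2 → p (v 1) (v 2)) ↔ ∀ a b, a < b → p a b :=
  ⟨fun h a b => h (threeLetters a b b), fun h _ => h _ _⟩

theorem NWord.avoids_iff_three {w : NWord} {x y z t : ℕ}
    (hσ : ∀ v : ℕ → ℕ, (∀ r ∈ [x, y, z, t], ∀ s ∈ [x, y, z, t], r < s → v r < v s) ↔
      v 1 < v 2 ∧ v 2 < v 3) :
    NWord.Avoids w [x, y, z, t] ↔ ∀ v : ℕ → ℕ, v 1 < v 2 → v 2 < v 3 →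
      ¬ [v x, v y, v z, v t] <+ w := by
  rw [NWord.avoids_iff]
  refine forall_congr' fun v => ?_
  rw [hσ, and_imp]
  rfl

theorem NWord.avoids_1123 {w : NWord} : NWord.Avoids w [1, 1, 2, 3] ↔
    ∀ a b c, a < b → b < c → ¬ [a, a, b, c] <+ w := by
  rw [NWord.avoids_iff_three (by simp; grind)]
  exact forall_threeLetters (p := fun a b c => ¬ [a, a, b, c] <+ w)

theorem NWord.avoids_1132 {w : NWord} : NWord.Avoids w [1, 1, 3, 2] ↔
    ∀ a b c, a < b → b < c → ¬ [a, a, c, b] <+ w := by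
  rw [NWord.avoids_iff_three (by simp; grind)]
  exact forall_threeLetters (p := fun a b c => ¬ [a, a, c, b] <+ w)

theorem NWord.avoids_1322 {w : NWord} : NWord.Avoids w [1, 3, 2, 2] ↔
    ∀ a b c, a < b → b < c → ¬ [a, c, b, b] <+ w := by
  rw [NWord.avoids_iff_three (by simp; grind)]
  exact forall_threeLetters (p := fun a b c => ¬ [a, c, b, b] <+ w)

theorem NWord.avoids_3122 {w : NWord} : NWord.Avoids w [3, 1, 2, 2] ↔
    ∀ a b c, a < b → b < c → ¬ [c, a, b, b] <+ w := by
  rw [NWord.avoids_iff_three (by simp; grind)]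
  exact forall_threeLetters (p := fun a b c => ¬ [c, a, b, b] <+ w)

theorem NWord.avoids_2133 {w : NWord} : NWord.Avoids w [2, 1, 3, 3] ↔
    ∀ a b c, a < b → b < c → ¬ [b, a, c, c] <+ w := by
  rw [NWord.avoids_iff_three (by simp; grind)]
  exact forall_threeLetters (p := fun a b c => ¬ [b, a, c, c] <+ w)

theorem NWord.avoids_2331 {w : NWord} : NWord.Avoids w [2, 3, 3, 1] ↔
    ∀ a b c, a < b → b < c → ¬ [b, c, c, a] <+ w := by
  rw [NWord.avoids_iff_three (by simp; grind)]
  exact forall_threeLetters (p := fun a b c => ¬ [b, c, c, a] <+ w)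

theorem NWord.avoids_1332 {w : NWord} : NWord.Avoids w [1, 3, 3, 2] ↔
    ∀ a b c, a < b → b < c → ¬ [a, c, c, b] <+ w := by
  rw [NWord.avoids_iff_three (by simp; grind)]
  exact forall_threeLetters (p := fun a b c => ¬ [a, c, c, b] <+ w)

theorem NWord.avoids_2213 {w : NWord} : NWord.Avoids w [2, 2, 1, 3] ↔
    ∀ a b c, a < b → b < c → ¬ [b, b, a, c] <+ w := by
  rw [NWord.avoids_iff_three (by simp; grind)]
  exact forall_threeLetters (p := fun a b c => ¬ [b, b, a, c] <+ w)

theorem NWord.avoids_2231 {w : NWord} : NWord.Avoids w [2, 2, 3, 1] ↔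
    ∀ a b c, a < b → b < c → ¬ [b, b, c, a] <+ w := by
  rw [NWord.avoids_iff_three (by simp; grind)]
  exact forall_threeLetters (p := fun a b c => ¬ [b, b, c, a] <+ w)

theorem NWord.avoids_1221 {w : NWord} : NWord.Avoids w [1, 2, 2, 1] ↔
    ∀ a b, a < b → ¬ [a, b, b, a] <+ w := by
  rw [NWord.avoids_iff, ← forall_twoLetters (p := fun a b => ¬ [a, b, b, a] <+ w)]
  refine forall_congr' fun v => ?_
  simp

theorem NWord.avoids_2112 {w : NWord} : NWord.Avoids w [2, 1, 1, 2] ↔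
    ∀ a b, a < b → ¬ [b, a, a, b] <+ w := by
  rw [NWord.avoids_iff, ← forall_twoLetters (p := fun a b => ¬ [b, a, a, b] <+ w)]
  refine forall_congr' fun v => ?_
  simp

theorem nonnesting_iff {w : NWord} : (NWord.Avoids w [1, 2, 2, 1] ∧ NWord.Avoids w [2, 1, 1, 2]) ↔
    ∀ a b, a ≠ b → ¬ [a, b, b, a] <+ w := by
  rw [NWord.avoids_1221, NWord.avoids_2112]
  constructor
  · rintro ⟨h1, h2⟩ a b hab
    rcases lt_or_gt_of_ne hab with h | h
    · exact h1 a b h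
    · exact h2 b a h
  · intro h
    exact ⟨fun a b hab => h a b hab.ne, fun a b hab => h b a hab.ne'⟩

/-! ### Transfer of patterns from the word to the order of its letters -/

namespace FifoTrace

variable {l w : List ℕ} {d : List DyckStep}

/-- The part `a b b` puts `a` before `b` in `l`, and the part `b b a` puts `b` before `a`. -/
theorem nonnesting (h : FifoTrace [] d l w) (hn : l.Nodup) {a b : ℕ} (hab : a ≠ b) :
    ¬ [a, b, b, a] <+ w := by
  intro hs
  have h1 : [a, b] <+ l := h.pair_of_abb hn hab (Sublist.trans (by simp) hs)
  have h2 : [b, a] <+ l := h.pair_of_aab hn hab.symm (Sublist.trans (by simp) hs)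
  have := hn.sublist (triple_of_pairs hn h1 h2)
  simp at this

theorem triple_of_aabc (h : FifoTrace [] d l w) (hn : l.Nodup) {a b c : ℕ} (hab : a ≠ b)
    (hac : a ≠ c) (hbc : b ≠ c) (hs : [a, a, b, c] <+ w) :
    [a, b, c] <+ l ∨ [a, c, b] <+ l :=
  triple_or_triple_of_left hbc (h.pair_of_aab hn hab (Sublist.trans (by simp) hs))
    (h.pair_of_aab hn hac (Sublist.trans (by simp) hs))

theorem triple_of_abcc (h : FifoTrace [] d l w) (hn : l.Nodup) {a b c : ℕ} (hab : a ≠ b)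
    (hac : a ≠ c) (hbc : b ≠ c) (hs : [a, b, c, c] <+ w) :
    [a, b, c] <+ l ∨ [b, a, c] <+ l :=
  triple_or_triple_of_right hab (h.pair_of_abb hn hac (Sublist.trans (by simp) hs))
    (h.pair_of_abb hn hbc (Sublist.trans (by simp) hs))

theorem triple_of_abbc (h : FifoTrace [] d l w) (hn : l.Nodup) {a b c : ℕ} (hab : a ≠ b)
    (hbc : b ≠ c) (hs : [a, b, b, c] <+ w) : [a, b, c] <+ l :=
  triple_of_pairs hn (h.pair_of_abb hn hab (Sublist.trans (by simp) hs))
    (h.pair_of_aab hn hbc (Sublist.trans (by simp) hs))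

theorem aabc_of_triple (h : FifoTrace [] d l w) {a b c : ℕ} (hs : [a, b, c] <+ l) :
    [a, a, b, c] <+ w := h.double (u := []) hs

theorem abbc_of_triple (h : FifoTrace [] d l w) {a b c : ℕ} (hs : [a, b, c] <+ l) :
    [a, b, b, c] <+ w := h.double (u := [a]) hs

theorem abcc_of_triple (h : FifoTrace [] d l w) {a b c : ℕ} (hs : [a, b, c] <+ l) :
    [a, b, c, c] <+ w := h.double (u := [a, b]) hs

/-- An occurrence of `aabc` does not fix the order of `b` and `c` in `l`; the two patterns together
forbid both orders. -/
theorem avoids_1123_1132 (h : FifoTrace [] d l w) (hn : l.Nodup) :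
    (NWord.Avoids w [1, 1, 2, 3] ∧ NWord.Avoids w [1, 1, 3, 2]) ↔
      AvoidsTriple (fun a b c => a < b ∧ a < c) l := by
  rw [NWord.avoids_1123, NWord.avoids_1132]
  constructor
  · rintro ⟨h1, h2⟩ a b c hs hr
    have hbc : b ≠ c := by have := hn.sublist hs; simp at this; tauto
    have := h.aabc_of_triple hs
    rcases lt_or_gt_of_ne hbc with hlt | hlt
    · exact h1 a b c (by omega) (by omega) this
    · exact h2 a c b (by omega) (by omega) this
  · intro hA
    constructor <;> intro a b c hab hbc hs <;>
      rcases h.triple_of_aabc hn (by omega) (by omega) (by omega) hs with h' | h' <;>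
      exact hA _ _ _ h' (by omega)

theorem avoids_1322_3122 (h : FifoTrace [] d l w) (hn : l.Nodup) :
    (NWord.Avoids w [1, 3, 2, 2] ∧ NWord.Avoids w [3, 1, 2, 2]) ↔
      AvoidsTriple (fun a b c => (a < c ∧ c < b) ∨ (b < c ∧ c < a)) l := by
  rw [NWord.avoids_1322, NWord.avoids_3122]
  constructor
  · rintro ⟨h1, h2⟩ a b c hs hr
    have := h.abcc_of_triple hs
    rcases hr with hr | hr
    · exact h1 a c b hr.1 hr.2 this
    · exact h2 b c a hr.1 hr.2 this
  · intro hA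
    constructor <;> intro a b c hab hbc hs <;>
      rcases h.triple_of_abcc hn (by omega) (by omega) (by omega) hs with h' | h' <;>
      exact hA _ _ _ h' (by omega)

/-- An occurrence of 2133 gives 213 or 123 in `l`, and 123 is already excluded by the first two
patterns. -/
theorem avoids_1123_1132_2133 (h : FifoTrace [] d l w) (hn : l.Nodup) :
    (NWord.Avoids w [1, 1, 2, 3] ∧ NWord.Avoids w [1, 1, 3, 2] ∧ NWord.Avoids w [2, 1, 3, 3]) ↔
      AvoidsTriple (fun a b c => (a < b ∧ a < c) ∨ (b < a ∧ a < c)) l := by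
  rw [← and_assoc, h.avoids_1123_1132 hn, NWord.avoids_2133]
  constructor
  · rintro ⟨h1, h2⟩ a b c hs hr
    rcases hr with hr | hr
    · exact h1 a b c hs hr
    · exact h2 b a c hr.1 hr.2 (h.abcc_of_triple hs)
  · intro hA
    refine ⟨fun a b c hs hr => hA a b c hs (Or.inl hr), fun a b c hab hbc hs => ?_⟩
    rcases h.triple_of_abcc hn (by omega) (by omega) (by omega) hs with h' | h' <;>
      exact hA _ _ _ h' (by omega)

/-- With the repeated letter in the middle there is no ambiguity: 2331 corresponds exactly to 231.
-/
theorem avoids_1123_1132_2331 (h : FifoTrace [] d l w) (hn : l.Nodup) :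
    (NWord.Avoids w [1, 1, 2, 3] ∧ NWord.Avoids w [1, 1, 3, 2] ∧ NWord.Avoids w [2, 3, 3, 1]) ↔
      AvoidsTriple (fun a b c => (a < b ∧ a < c) ∨ (c < a ∧ a < b)) l := by
  rw [← and_assoc, h.avoids_1123_1132 hn, NWord.avoids_2331]
  constructor
  · rintro ⟨h1, h2⟩ a b c hs hr
    rcases hr with hr | hr
    · exact h1 a b c hs hr
    · exact h2 c a b hr.1 hr.2 (h.abbc_of_triple hs)
  · intro hA
    exact ⟨fun a b c hs hr => hA a b c hs (Or.inl hr), fun a b c hab hbc hs =>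
      hA _ _ _ (h.triple_of_abbc hn (by omega) (by omega) hs) (by omega)⟩

/-- An occurrence of 3122 gives 312 or 132 in `l`, and 132 is already excluded by the first two
patterns. -/
theorem avoids_1123_1132_3122 (h : FifoTrace [] d l w) (hn : l.Nodup) :
    (NWord.Avoids w [1, 1, 2, 3] ∧ NWord.Avoids w [1, 1, 3, 2] ∧ NWord.Avoids w [3, 1, 2, 2]) ↔
      AvoidsTriple (fun a b c => (a < b ∧ a < c) ∨ (b < c ∧ c < a)) l := by
  rw [← and_assoc, h.avoids_1123_1132 hn, NWord.avoids_3122]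
  constructor
  · rintro ⟨h1, h2⟩ a b c hs hr
    rcases hr with hr | hr
    · exact h1 a b c hs hr
    · exact h2 b c a hr.1 hr.2 (h.abcc_of_triple hs)
  · intro hA
    refine ⟨fun a b c hs hr => hA a b c hs (Or.inl hr), fun a b c hab hbc hs => ?_⟩
    rcases h.triple_of_abcc hn (by omega) (by omega) (by omega) hs with h' | h' <;>
      exact hA _ _ _ h' (by omega)

theorem avoids_1332_2213_2231 (h : FifoTrace [] d l w) (hn : l.Nodup) :
    (NWord.Avoids w [1, 3, 3, 2] ∧ NWord.Avoids w [2, 2, 1, 3] ∧ NWord.Avoids w [2, 2, 3, 1]) ↔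
      AvoidsTriple (fun a b c => (a < c ∧ c < b) ∨ (b < a ∧ a < c) ∨ (c < a ∧ a < b)) l := by
  rw [NWord.avoids_1332, NWord.avoids_2213, NWord.avoids_2231]
  constructor
  · rintro ⟨h1, h2, h3⟩ a b c hs hr
    rcases hr with hr | hr | hr
    · exact h1 a c b hr.1 hr.2 (h.abbc_of_triple hs)
    · exact h2 b a c hr.1 hr.2 (h.aabc_of_triple hs)
    · exact h3 c a b hr.1 hr.2 (h.aabc_of_triple hs)
  · intro hA
    refine ⟨fun a b c hab hbc hs =>
      hA _ _ _ (h.triple_of_abbc hn (by omega) (by omega) hs) (by omega), ?_, ?_⟩ <;>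
      intro a b c hab hbc hs <;>
      rcases h.triple_of_aabc hn (by omega) (by omega) (by omega) hs with h' | h' <;>
      exact hA _ _ _ h' (by omega)

/-- From the empty queue every multiplicity in `w` is twice that in `l`, so the comparison with two
copies of `1, …, n` can be halved. -/
theorem isDoublePerm_iff (h : FifoTrace [] d l w) {n : ℕ} :
    IsDoublePerm n w ↔ l ∈ arrangements (Finset.Icc 1 n) := by
  have h1 : l ∈ arrangements (Finset.Icc 1 n) ↔ l ~ range' 1 n := by
    have hr : (range' 1 n).toFinset = Finset.Icc 1 n := by
      ext x; simp [mem_range'_1]; omega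
    constructor
    · rintro ⟨h2, h3⟩
      exact perm_of_nodup_nodup_toFinset_eq h2 nodup_range' (by rw [h3, hr])
    · intro hp
      exact ⟨hp.nodup_iff.2 nodup_range', by rw [← hr]; exact toFinset_eq_of_perm _ _ hp⟩
  rw [h1, IsDoublePerm, perm_iff_count, perm_iff_count]
  refine forall_congr' fun x => ?_
  rw [h.count_eq, count_append, count_nil]
  omega

end FifoTrace

/-! ### The bijection and the final count -/

theorem exists_trace_of_mem_nonnestingPerms {n : ℕ} {w : NWord} (hw : w ∈ nonnestingPerms n) :
    ∃ d l, FifoTrace [] d l w := by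
  refine FifoTrace.exists_of_nonnesting w [] nodup_nil (fun x hx => ?_) ?_
  · have h1 := perm_iff_count.1 hw.1 x
    have h2 := nodup_iff_count_le_one.1 (nodup_range' (s := 1) (n := n)) x
    have h3 := count_pos_iff.2 hx
    simp only [nil_append, count_append] at h1 h3 ⊢
    omega
  · simpa using nonnesting_iff.1 hw.2

theorem nonnestingCount_eq {n : ℕ} {Λ : Set NWord} {R : ℕ → ℕ → ℕ → Prop}
    (hΛ : ∀ d l w, FifoTrace [] d l w → l.Nodup →
      ((∀ σ ∈ Λ, NWord.Avoids w σ) ↔ AvoidsTriple R l)) :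
    nonnestingCount n Λ = arrangementCount (AvoidsTriple R) (Finset.Icc 1 n) * catalan n := by
  have hcat : (Set.univ : Set {p : DyckWord // p.semilength = n}).ncard = catalan n := by
    rw [Set.ncard_univ, Nat.card_eq_fintype_card, DyckWord.card_dyckWord_semilength_eq_catalan]
  have hex : ∀ x ∈ {l | l ∈ arrangements (Finset.Icc 1 n) ∧ AvoidsTriple R l} ×ˢ
      (Set.univ : Set {p : DyckWord // p.semilength = n}),
      ∃ w, FifoTrace [] x.2.1.toList x.1 w := by
    rintro ⟨l, p, hp⟩ ⟨⟨hl, -⟩, -⟩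
    refine FifoTrace.exists_word _ _ _ ?_ (by simpa using p.count_U_eq_count_D)
      (by simpa using p.count_D_le_count_U)
    have : l.length = n := by rw [← toFinset_card_of_nodup hl.1, hl.2]; simp
    rw [this]; exact hp
  rw [← hcat, arrangementCount, ← Set.ncard_prod, nonnestingCount]
  symm
  -- The word is chosen from an existence statement: `unique` makes the map injective, and
  -- `functional` identifies the chosen word with a given one in the proof of surjectivity.
  refine Set.ncard_congr (fun x hx => (hex x hx).choose) ?_ ?_ ?_
  · intro x hx
    have h := (hex x hx).choose_spec
    refine ⟨⟨h.isDoublePerm_iff.2 hx.1.1, nonnesting_iff.2 fun a b hab => ?_⟩, ?_⟩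
    · exact h.nonnesting hx.1.1.1 hab
    · exact (hΛ _ _ _ h hx.1.1.1).2 hx.1.2
  · rintro ⟨l, p, hp⟩ ⟨l', p', hp'⟩ hx hx' heq
    have h := (hex _ hx).choose_spec
    have h' := (hex _ hx').choose_spec
    rw [← heq] at h'
    obtain ⟨h1, h2⟩ := h.unique h' hx.1.1.1 hx'.1.1.1
    simp only [Prod.mk.injEq, Subtype.mk.injEq]
    exact ⟨h2, DyckWord.ext h1⟩
  · rintro w ⟨hw, hA⟩
    obtain ⟨d, l, h⟩ := exists_trace_of_mem_nonnestingPerms hw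
    have hl := h.isDoublePerm_iff.1 hw.1
    have hlen : l.length = n := by rw [← toFinset_card_of_nodup hl.1, hl.2]; simp
    have hx : (l, (⟨⟨d, by simpa using h.balanced, by simpa using h.prefix_le⟩,
        h.length_eq.trans hlen⟩ : {p : DyckWord // p.semilength = n})) ∈
        {l | l ∈ arrangements (Finset.Icc 1 n) ∧ AvoidsTriple R l} ×ˢ
        (Set.univ : Set {p : DyckWord // p.semilength = n}) :=
      ⟨⟨hl, (hΛ _ _ _ h hl.1).1 hA⟩, trivial⟩
    exact ⟨_, hx, (hex _ hx).choose_spec.functional h⟩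

theorem mul_catalan_eq_choose {n : ℕ} (hn : 1 ≤ n) : n * catalan n = (2 * n).choose (n - 1) := by
  obtain ⟨k, rfl⟩ := Nat.exists_eq_add_of_le' hn
  have h1 := succ_mul_catalan_eq_centralBinom (k + 1)
  have h2 := Nat.choose_succ_right_eq (2 * (k + 1)) k
  rw [Nat.centralBinom] at h1
  rw [← h1, show 2 * (k + 1) - k = k + 2 by omega] at h2
  rw [Nat.add_sub_cancel]
  -- With `n = k + 1`, both sides times `k + 2` equal `k + 1` times the central binomial
  -- coefficient.
  apply Nat.eq_of_mul_eq_mul_right (show 0 < k + 2 by omega)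
  rw [← h2]; ring

theorem mainTheorem9 (n : ℕ) (hn : 1 ≤ n) :
    (nonnestingCount n {[1, 1, 2, 3], [1, 1, 3, 2]} = 2 ^ (n - 1) * catalan n ∧
      nonnestingCount n {[1, 3, 2, 2], [3, 1, 2, 2]} = 2 ^ (n - 1) * catalan n) ∧
    nonnestingCount n {[1, 1, 2, 3], [1, 1, 3, 2], [2, 1, 3, 3]} = shiftedFib n * catalan n ∧
    (nonnestingCount n {[1, 1, 2, 3], [1, 1, 3, 2], [2, 3, 3, 1]} = (2 * n).choose (n - 1) ∧
      nonnestingCount n {[1, 1, 2, 3], [1, 1, 3, 2], [3, 1, 2, 2]} = (2 * n).choose (n - 1) ∧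
      nonnestingCount n {[1, 3, 3, 2], [2, 2, 1, 3], [2, 2, 3, 1]} = (2 * n).choose (n - 1)) := by
  have hcard : (Finset.Icc 1 n).card = n - 1 + 1 := by simp; omega
  have hn' : n - 1 + 1 = n := by omega
  refine ⟨⟨?_, ?_⟩, ?_, ?_, ?_, ?_⟩
  · rw [nonnestingCount_eq fun d l w h hl => by simpa using h.avoids_1123_1132 hl,
      count_123_132 _ _ hcard]
  · rw [nonnestingCount_eq fun d l w h hl => by simpa using h.avoids_1322_3122 hl,
      count_132_312 _ _ hcard]
  · rw [nonnestingCount_eq fun d l w h hl => by simpa using h.avoids_1123_1132_2133 hl,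
      count_123_132_213 _ _ hcard, hn', shiftedFib]
  · rw [nonnestingCount_eq fun d l w h hl => by simpa using h.avoids_1123_1132_2331 hl,
      count_123_132_231 _ _ hcard, hn', mul_catalan_eq_choose hn]
  · rw [nonnestingCount_eq fun d l w h hl => by simpa using h.avoids_1123_1132_3122 hl,
      count_123_132_312 _ _ hcard, hn', mul_catalan_eq_choose hn]
  · rw [nonnestingCount_eq fun d l w h hl => by simpa using h.avoids_1332_2213_2231 hl,
      count_132_213_231 _ _ hcard, hn', mul_catalan_eq_choose hn]
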